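/- **Setting.** Fix $d$. Tensors in $\mathbb R^{n_1\times\cdots\times n_d}$ carry the Frobenius norm, $\mathrm{Mat}_i$ is the mode-$i$ unfolding with inverse $\mathrm{Ten}_i$, $\mathcal M_\rho=\{W:\operatorname{rank}\mathrm{Mat}_i(W)=r_i,\ i=1,\dots,d\}$ for $\rho=(r_1,\dots,r_d)$, and for $Y=C\times_{i=1}^dU_i\in\mathcal M_\rho$ with orthonormal factors, $T_Y\mathcal M_\rho$ is the tangent space of all $\delta C\times_{i=1}^d U_i+\sum_j C\times_j\delta U_j\times_{k\ne j}U_k$, where $\delta U_j^\top U_j+U_j^\top\delta U_j=0$. A Tucker representation $C\times_{i=1}^d U_i$ is called proper if the $U_i$ have orthonormal columns and $C$ has full Tucker rank. **Algorithm.** One step of rank-adaptive TDLRT for a loss $\mathcal L$, with step $\lambda>0$, relative tolerance $\tau\ge0$ and exact integration, maps a proper $(C,\{U_i\})$ to a new pair as follows. For every mode $i$: take a QR decomposition $\mathrm{Mat}_i(C)^\top=Q_iS_i^\top$; follow $\dot K_i=-\nabla_{K_i}\mathcal L(\mathrm{Ten}_i(Q_i^\top)\times_{j\ne i}U_j\times_iK_i)$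 from $K_i(0)=U_iS_i$ on $[0,\lambda]$; let the columns of $U_i^{\rm new}$ be an orthonormal basis of the range of $[K_i(\lambda)\mid U_i]$. Then follow $\dot C=-\nabla_C\mathcal L(C\times_{i=1}^d U_i^{\rm new})$ on $[0,\lambda]$ from $C(0)=C\times_{i=1}^d (U_i^{\rm new})^\top U_i$, ending at $C^{\rm new}$. Finally choose matrices $U_i'$ with orthonormal columns such that $C'=C^{\rm new}\times_{i=1}^d U_i'^\top$ has full Tucker rank and $\|C^{\rm new}-C'\times_{i=1}^d U_i'\|\le\tau\|C^{\rm new}\|$; the new pair is $(C',\{U_i^{\rm new}U_i'\})$. **Theorem.** For all $L_1,L_2,T$ there are constants $c_1,c_2\ge 0$ depending only on $d,L_1,L_2,T$ and, for every $R$, a constant $c_3\ge 0$ depending only on $d,L_1,L_2,T,R$, such that the following holds for all sizes $n_1,\dots,n_d$, all $\mathcal L:\mathbb R^{n_1\times\cdots\times n_d}\to\mathbb R$, and all $k\in\mathbb N$, $\lambda>0$, $\tau\ge0$, $\varepsilon\ge0$, $\delta>0$ with $k\lambda\le T$. Let $W$ solve $\dot W=-\nabla\mathcal L(W)$ on $[0,k\lambda]$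 with $\|W(0)\|\le R$, let $C_0\times_{i=1}^d U_{0,i}=W(0)$ be proper, and let $(C_m,\{U_{m,i}\}_i)$, $m=0,\dots,k$, be produced by $k$ steps of the algorithm, with ranks $\rho_m$. Assume: 1. for every $t\in[0,k\lambda]$, $\mathcal L$ is differentiable on the open ball $B(W(t),\delta)$, and there $\|\nabla\mathcal L(Y)\|\le L_1$ and $\|\nabla\mathcal L(Y_1)-\nabla\mathcal L(Y_2)\|\le L_2\|Y_1-Y_2\|$; 2. for every $m<k$ and every $Y\in\mathcal M_{\rho_m}\cap B(W(m\lambda),\delta)$ there is $Z\in T_Y\mathcal M_{\rho_m}$ with $\|-\nabla\mathcal L(Y)-Z\|\le\varepsilon$; 3. the bound below does not exceed the radius of the neighbourhood: $c_1\varepsilon+c_2\lambda+c_3\tau/\lambda\le\delta$. Then $$\|W(k\lambda)-C_k\times_{i=1}^d U_{k,i}\|\le c_1\varepsilon+c_2\lambda+c_3\,\tau/\lambda .$$ In particular, the constants do not depend on the sizes, the ranks or the singular values of any unfolding. -/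

import Mathlib

/-! Real tensors of order `d` in Tucker format, the manifold of tensors of given Tucker rank, and the
rank-adaptive dynamical low-rank training step (TDLRT). -/

open scoped Matrix

/-- Real tensors of size `n 0 × ⋯ × n (d-1)`, with the Frobenius inner product and norm. -/
abbrev Tensor {d : ℕ} (n : Fin d → ℕ) : Type :=
  EuclideanSpace ℝ (∀ i, Fin (n i))

/-- The `i`-th unfolding `Mat_i(W)`: rows are indexed by the `i`-th index, columns by all others. -/
def unfoldMode {d : ℕ} {n : Fin d → ℕ} (i : Fin d) (W : Tensor n) :
    Matrix (Fin (n i)) (∀ j : {j // j ≠ i}, Fin (n j)) ℝ :=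
  Matrix.of fun a b => W ((Equiv.piSplitAt i (fun j => Fin (n j))).symm (a, b))

/-- The tensorization `Ten_i` along mode `i`, inverse to `Mat_i`. -/
def foldMode {d : ℕ} {n : Fin d → ℕ} (i : Fin d)
    (A : Matrix (Fin (n i)) (∀ j : {j // j ≠ i}, Fin (n j)) ℝ) : Tensor n :=
  WithLp.toLp 2 fun x => A (x i) (fun j => x j)

/-- The multilinear product `C ×₁ U₁ ×₂ ⋯ ×_d U_d`. -/
def tucker {d : ℕ} {n r : Fin d → ℕ} (C : Tensor r)
    (U : ∀ i, Matrix (Fin (n i)) (Fin (r i)) ℝ) : Tensor n :=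
  WithLp.toLp 2 fun x => ∑ a : ∀ i, Fin (r i), C a * ∏ i, U i (x i) (a i)

/-- The set `M_ρ` of tensors of Tucker rank exactly `ρ`. -/
def tuckerManifold {d : ℕ} (n ρ : Fin d → ℕ) : Set (Tensor n) :=
  {W | ∀ i, (unfoldMode i W).rank = ρ i}

/-- The tangent space of the Stiefel manifold of matrices with orthonormal columns at `U`. -/
def stiefelTangent {p q : ℕ} (U : Matrix (Fin p) (Fin q) ℝ) : Set (Matrix (Fin p) (Fin q) ℝ) :=
  {D | Uᵀ * D + Dᵀ * U = 0}

/-- The tangent space `T_Y M_ρ`: all `δC ×ᵢ Uᵢ + ∑ⱼ C ×ⱼ δUⱼ ×_{k≠j} U_k`, where `Y = C ×ᵢ Uᵢ` with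
orthonormal factors (the set does not depend on the chosen representation of `Y`). -/
def tuckerTangent {d : ℕ} {n : Fin d → ℕ} (ρ : Fin d → ℕ) (Y : Tensor n) : Set (Tensor n) :=
  {Z | ∃ (C : Tensor ρ) (U : ∀ i, Matrix (Fin (n i)) (Fin (ρ i)) ℝ),
      (∀ i, (U i)ᵀ * U i = 1) ∧ Y = tucker C U ∧
      ∃ (δC : Tensor ρ) (δU : ∀ i, Matrix (Fin (n i)) (Fin (ρ i)) ℝ),
        (∀ i, δU i ∈ stiefelTangent (U i)) ∧
        Z = tucker δC U + ∑ j, tucker C (Function.update U j (δU j))}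

/-- `x` solves the gradient flow `x' = -∇ f(x)` on the time interval `[0, T]`. -/
def IsGradientFlow {E : Type*} [NormedAddCommGroup E] [InnerProductSpace ℝ E] [CompleteSpace E]
    (f : E → ℝ) (T : ℝ) (x : ℝ → E) : Prop :=
  ∀ t ∈ Set.Icc 0 T, HasDerivWithinAt x (-gradient f (x t)) (Set.Icc 0 T) t

/-- `p × q` matrices with the Frobenius inner product, in which the basis matrices evolve. -/
abbrev FrobMatrix (p q : ℕ) : Type := EuclideanSpace ℝ (Fin p × Fin q)

/-- The matrix with the same entries. -/
def FrobMatrix.toMatrix {p q : ℕ} (K : FrobMatrix p q) : Matrix (Fin p) (Fin q) ℝ :=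
  Matrix.of fun a b => K (a, b)

/-- The data of a tensor in Tucker format: ranks, core and factors. -/
structure TuckerFactors {d : ℕ} (n : Fin d → ℕ) where
  /-- The ranks `ρ = (r₁, …, r_d)`. -/
  rank : Fin d → ℕ
  /-- The core tensor `C`. -/
  core : Tensor rank
  /-- The factor matrices `Uᵢ`. -/
  basis : ∀ i, Matrix (Fin (n i)) (Fin (rank i)) ℝ

/-- The full tensor `C ×ᵢ Uᵢ`. -/
def TuckerFactors.toTensor {d : ℕ} {n : Fin d → ℕ} (X : TuckerFactors n) : Tensor n :=
  tucker X.core X.basis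

/-- The factors have orthonormal columns and the core has full Tucker rank. -/
def TuckerFactors.IsProper {d : ℕ} {n : Fin d → ℕ} (X : TuckerFactors n) : Prop :=
  (∀ i, (X.basis i)ᵀ * X.basis i = 1) ∧ X.core ∈ tuckerManifold X.rank X.rank

/-- `A = Q R` is a (reduced) QR decomposition: `Q` has orthonormal columns, `R` is upper triangular. -/
def IsQR {ι : Type*} [Fintype ι] {q : ℕ} (A Q : Matrix ι (Fin q) ℝ)
    (R : Matrix (Fin q) (Fin q) ℝ) : Prop :=
  A = Q * R ∧ Qᵀ * Q = 1 ∧ R.BlockTriangular id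

/-- The columns of `B` are an orthonormal basis of the range of the block matrix `[K | U]`. -/
def IsOrthonormalRangeBasis {p q s : ℕ} (K U : Matrix (Fin p) (Fin q) ℝ)
    (B : Matrix (Fin p) (Fin s) ℝ) : Prop :=
  Bᵀ * B = 1 ∧
    LinearMap.range B.mulVecLin = LinearMap.range (Matrix.fromCols K U).mulVecLin

/-- `B` is a new basis for mode `i`, obtained from `X`: with the QR decomposition
`Mat_i(C)ᵀ = Q Sᵀ`, the matrix `K = Uᵢ S` is moved for time `h` along the gradient flow of
`K ↦ 𝓛(Ten_i(Qᵀ) ×_{j≠i} Uⱼ ×ᵢ K)`, and `B` is an orthonormal basis of the range of `[K(h) | Uᵢ]`. -/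
def IsBasisUpdate {d : ℕ} {n : Fin d → ℕ} (𝓛 : Tensor n → ℝ) (h : ℝ) (X : TuckerFactors n)
    (i : Fin d) {s : ℕ} (B : Matrix (Fin (n i)) (Fin s) ℝ) : Prop :=
  ∃ (Q : Matrix (∀ j : {j // j ≠ i}, Fin (X.rank j)) (Fin (X.rank i)) ℝ)
    (S : Matrix (Fin (X.rank i)) (Fin (X.rank i)) ℝ)
    (K : ℝ → FrobMatrix (n i) (X.rank i)),
    IsQR (unfoldMode i X.core)ᵀ Q Sᵀ ∧
    (K 0).toMatrix = X.basis i * S ∧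
    IsGradientFlow
      (fun K' : FrobMatrix (n i) (X.rank i) =>
        𝓛 (tucker (foldMode i Qᵀ) (Function.update X.basis i K'.toMatrix))) h K ∧
    IsOrthonormalRangeBasis (K h).toMatrix (X.basis i) B

/-- `C'`, `V` is a (possibly truncated) Tucker decomposition of the tensor `C` up to relative error
`τ`: the `Vᵢ` have orthonormal columns, `C' = C ×ᵢ Vᵢᵀ` has full Tucker rank, and
`‖C - C' ×ᵢ Vᵢ‖ ≤ τ ‖C‖`. -/
def IsTuckerRounding {d : ℕ} {s r : Fin d → ℕ} (τ : ℝ) (C : Tensor s) (C' : Tensor r)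
    (V : ∀ i, Matrix (Fin (s i)) (Fin (r i)) ℝ) : Prop :=
  (∀ i, (V i)ᵀ * V i = 1) ∧ C' = tucker C (fun i => (V i)ᵀ) ∧ C' ∈ tuckerManifold r r ∧
    ‖C - tucker C' V‖ ≤ τ * ‖C‖

/-- One step of the rank-adaptive TDLRT algorithm from `X` to `X'`, with step size `h`, relative
truncation tolerance `τ` and exact integration of the factor equations. -/
def IsTDLRTStep {d : ℕ} {n : Fin d → ℕ} (𝓛 : Tensor n → ℝ) (h τ : ℝ)
    (X X' : TuckerFactors n) : Prop :=
  ∃ (s : Fin d → ℕ) (B : ∀ i, Matrix (Fin (n i)) (Fin (s i)) ℝ) (C : ℝ → Tensor s)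
    (V : ∀ i, Matrix (Fin (s i)) (Fin (X'.rank i)) ℝ),
    (∀ i, IsBasisUpdate 𝓛 h X i (B i)) ∧
    C 0 = tucker X.core (fun i => (B i)ᵀ * X.basis i) ∧
    IsGradientFlow (fun C' : Tensor s => 𝓛 (tucker C' B)) h C ∧
    IsTuckerRounding τ (C h) X'.core V ∧
    ∀ i, X'.basis i = B i * V i

/-! Rank-adaptive TDLRT follows the full gradient flow with an error that does not see the singular
values of the unfoldings. The whole comparison is with explicit Euler steps for `W' = -∇𝓛(W)`: with
`‖∇𝓛‖ < M` and Lipschitz constant `L`, the exact flow, the core flow and each basis flow differ from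
an Euler step by at most `L M h²`. All three are flows of `𝓛 ∘ ι` for a linear isometry `ι` into the
space of tensors (the identity, `tuckerIsometry`, `basisIsometry`), so one estimate serves for all:
`GradientBoundedOnBall.norm_flow_sub_euler_le`.

Let `Y` be the current tensor, `F = -∇𝓛(Y)`, and `P_i = B_i B_iᵀ` the projection of mode `i` onto the
new basis. The core flow is the gradient flow projected by `P = ∏ P_i`, hence one has to bound
`(1 - P) F`, and by `norm_sub_tucker_le_sum` it suffices to bound each `(1 - P_i) F`. Replace `F` by a
tangent vector `Z` at distance `ε`. As `P_i` fixes `Y`, only the variation of the `i`-th factor survives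
in `D = (1 - P_i) Z`, and `D = Y ×ᵢ G` for some matrix `G` (`exists_modeMul_tangent_eq`), so `D` lies in
the range of the isometry `ι` in which `K_i` moves. The displacement `K_i(h) - K_i(0)` is `h ι* F` up to
`L M h²` and is captured by `B_i`, so it is orthogonal to `D`; thus `⟨F, D⟩ ≤ L M h ‖D‖`, and
`‖D‖² = ⟨Z, D⟩` gives `‖D‖ ≤ ε + L M h`. No inverse of a core unfolding is ever taken.

The rounding is an orthogonal projection of the core, so `‖Y_m‖ ≤ R + M T` independently of `τ`, and a
rounding error is at most `τ (R + M T)`. The local errors (`IsTDLRTStep.local_error`) are then summed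
by a discrete Gronwall argument, which also shows that no flow leaves the balls where `𝓛` is
controlled. -/

/-! ### The multilinear product -/

theorem tucker_apply {d : ℕ} {n r : Fin d → ℕ} (C : Tensor r)
    (U : ∀ i, Matrix (Fin (n i)) (Fin (r i)) ℝ) (x : ∀ i, Fin (n i)) :
    tucker C U x = ∑ a : ∀ i, Fin (r i), C a * ∏ i, U i (x i) (a i) := rfl

theorem tucker_add {d : ℕ} {n r : Fin d → ℕ} (C D : Tensor r)
    (U : ∀ i, Matrix (Fin (n i)) (Fin (r i)) ℝ) :
    tucker (C + D) U = tucker C U + tucker D U := by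
  ext x
  simp [tucker_apply, add_mul, Finset.sum_add_distrib]

theorem tucker_smul {d : ℕ} {n r : Fin d → ℕ} (c : ℝ) (C : Tensor r)
    (U : ∀ i, Matrix (Fin (n i)) (Fin (r i)) ℝ) :
    tucker (c • C) U = c • tucker C U := by
  ext x
  simp [tucker_apply, mul_assoc, Finset.mul_sum]

/-- `C ↦ C ×ᵢ Uᵢ` as a linear map. -/
def tuckerLinearMap {d : ℕ} {n r : Fin d → ℕ} (U : ∀ i, Matrix (Fin (n i)) (Fin (r i)) ℝ) :
    Tensor r →ₗ[ℝ] Tensor n where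
  toFun C := tucker C U
  map_add' C D := tucker_add C D U
  map_smul' c C := tucker_smul c C U

theorem tucker_sub {d : ℕ} {n r : Fin d → ℕ} (C D : Tensor r)
    (U : ∀ i, Matrix (Fin (n i)) (Fin (r i)) ℝ) :
    tucker (C - D) U = tucker C U - tucker D U :=
  map_sub (tuckerLinearMap U) C D

theorem tucker_sum {d : ℕ} {n r : Fin d → ℕ} {ι : Type*} (t : Finset ι) (C : ι → Tensor r)
    (U : ∀ i, Matrix (Fin (n i)) (Fin (r i)) ℝ) :
    tucker (∑ j ∈ t, C j) U = ∑ j ∈ t, tucker (C j) U :=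
  map_sum (tuckerLinearMap U) C t

theorem tucker_tucker {d : ℕ} {n r s : Fin d → ℕ} (C : Tensor s)
    (U : ∀ i, Matrix (Fin (r i)) (Fin (s i)) ℝ) (V : ∀ i, Matrix (Fin (n i)) (Fin (r i)) ℝ) :
    tucker (tucker C U) V = tucker C (fun i => V i * U i) := by
  ext x
  simp only [tucker_apply, Matrix.mul_apply, Finset.prod_univ_sum, Fintype.piFinset_univ,
    Finset.sum_mul, Finset.mul_sum, Finset.prod_mul_distrib]
  rw [Finset.sum_comm]
  refine Finset.sum_congr rfl fun a _ => Finset.sum_congr rfl fun b _ => ?_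
  ring

theorem tucker_one {d : ℕ} {n : Fin d → ℕ} (C : Tensor n) :
    tucker C (fun i => (1 : Matrix (Fin (n i)) (Fin (n i)) ℝ)) = C := by
  ext x
  rw [tucker_apply, Finset.sum_eq_single x]
  · simp
  · intro a _ hax
    obtain ⟨i, hi⟩ := Function.ne_iff.1 hax
    have h1 : (1 : Matrix (Fin (n i)) (Fin (n i)) ℝ) (x i) (a i) = 0 :=
      Matrix.one_apply_ne (Ne.symm hi)
    rw [Finset.prod_eq_zero (Finset.mem_univ i) h1, mul_zero]
  · simp

/-- Transposing all factors gives the adjoint map for the Frobenius inner product. -/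
theorem inner_tucker_left {d : ℕ} {n r : Fin d → ℕ} (C : Tensor r)
    (U : ∀ i, Matrix (Fin (n i)) (Fin (r i)) ℝ) (W : Tensor n) :
    inner ℝ (tucker C U) W = inner ℝ C (tucker W fun i => (U i)ᵀ) := by
  simp only [PiLp.inner_apply, tucker_apply, RCLike.inner_apply, conj_trivial, Finset.mul_sum,
    Finset.sum_mul, Matrix.transpose_apply]
  rw [Finset.sum_comm]
  refine Finset.sum_congr rfl fun a _ => Finset.sum_congr rfl fun b _ => ?_
  ring

theorem norm_tucker_of_orthonormal {d : ℕ} {n r : Fin d → ℕ} (C : Tensor r)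
    (U : ∀ i, Matrix (Fin (n i)) (Fin (r i)) ℝ) (hU : ∀ i, (U i)ᵀ * U i = 1) :
    ‖tucker C U‖ = ‖C‖ := by
  have h : inner ℝ (tucker C U) (tucker C U) = inner ℝ C C := by
    rw [inner_tucker_left, tucker_tucker]
    simp only [hU, tucker_one]
  rw [real_inner_self_eq_norm_sq, real_inner_self_eq_norm_sq] at h
  exact (sq_eq_sq₀ (norm_nonneg _) (norm_nonneg _)).1 h

/-- Multiplication by orthogonal projections in all modes is a contraction. -/
theorem norm_tucker_le_of_projection {d : ℕ} {n : Fin d → ℕ} (W : Tensor n)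
    (A : ∀ i, Matrix (Fin (n i)) (Fin (n i)) ℝ) (hT : ∀ i, (A i)ᵀ = A i)
    (hA : ∀ i, A i * A i = A i) : ‖tucker W A‖ ≤ ‖W‖ := by
  have h : inner ℝ (tucker W A) (tucker W A) = inner ℝ W (tucker W A) := by
    rw [inner_tucker_left, tucker_tucker]
    simp only [hT, hA]
  have h2 := real_inner_le_norm W (tucker W A)
  rw [← h, real_inner_self_eq_norm_sq, sq] at h2
  by_contra! hlt
  have : 0 < ‖tucker W A‖ := (norm_nonneg _).trans_lt hlt
  nlinarith

/-- `C ↦ C ×ᵢ Uᵢ` as an isometry, for factors with orthonormal columns. -/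
def tuckerIsometry {d : ℕ} {n r : Fin d → ℕ} (U : ∀ i, Matrix (Fin (n i)) (Fin (r i)) ℝ)
    (hU : ∀ i, (U i)ᵀ * U i = 1) : Tensor r →ₗᵢ[ℝ] Tensor n where
  toLinearMap := tuckerLinearMap U
  norm_map' C := norm_tucker_of_orthonormal C U hU

theorem adjoint_tuckerIsometry {d : ℕ} {n r : Fin d → ℕ}
    (U : ∀ i, Matrix (Fin (n i)) (Fin (r i)) ℝ) (hU : ∀ i, (U i)ᵀ * U i = 1) (W : Tensor n) :
    (tuckerIsometry U hU).toContinuousLinearMap.adjoint W = tucker W fun i => (U i)ᵀ := by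
  refine ext_inner_left ℝ fun C => ?_
  rw [ContinuousLinearMap.adjoint_inner_right]
  exact inner_tucker_left C U W

/-! ### Changing one mode -/

theorem tucker_update_apply {d : ℕ} {n r : Fin d → ℕ} (C : Tensor r)
    (U : ∀ i, Matrix (Fin (n i)) (Fin (r i)) ℝ) (i : Fin d)
    (K : Matrix (Fin (n i)) (Fin (r i)) ℝ) (x : ∀ i, Fin (n i)) :
    tucker C (Function.update U i K) x =
      ∑ a : ∀ i, Fin (r i), C a * (K (x i) (a i) * ∏ j ∈ Finset.univ.erase i, U j (x j) (a j)) := by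
  rw [tucker_apply]
  refine Finset.sum_congr rfl fun a _ => ?_
  rw [← Finset.mul_prod_erase _ _ (Finset.mem_univ i), Function.update_self]
  congr 2
  refine Finset.prod_congr rfl fun j hj => ?_
  rw [Function.update_of_ne (Finset.ne_of_mem_erase hj)]

theorem tucker_update_add {d : ℕ} {n r : Fin d → ℕ} (C : Tensor r)
    (U : ∀ i, Matrix (Fin (n i)) (Fin (r i)) ℝ) (i : Fin d)
    (K K' : Matrix (Fin (n i)) (Fin (r i)) ℝ) :
    tucker C (Function.update U i (K + K')) =
      tucker C (Function.update U i K) + tucker C (Function.update U i K') := by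
  ext x
  simp [tucker_update_apply, add_mul, mul_add, Finset.sum_add_distrib]

theorem tucker_update_smul {d : ℕ} {n r : Fin d → ℕ} (C : Tensor r)
    (U : ∀ i, Matrix (Fin (n i)) (Fin (r i)) ℝ) (i : Fin d) (c : ℝ)
    (K : Matrix (Fin (n i)) (Fin (r i)) ℝ) :
    tucker C (Function.update U i (c • K)) = c • tucker C (Function.update U i K) := by
  ext x
  simp only [tucker_update_apply, Matrix.smul_apply, PiLp.smul_apply, smul_eq_mul, Finset.mul_sum]
  exact Finset.sum_congr rfl fun a _ => by ring

theorem tucker_update_zero {d : ℕ} {n r : Fin d → ℕ} (C : Tensor r)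
    (U : ∀ i, Matrix (Fin (n i)) (Fin (r i)) ℝ) (i : Fin d) :
    tucker C (Function.update U i 0) = 0 := by
  simpa using tucker_update_smul C U i 0 0

theorem mul_update_eq_update {d : ℕ} {n r s : Fin d → ℕ} (i : Fin d)
    (V : ∀ j, Matrix (Fin (n j)) (Fin (r j)) ℝ) (A : Matrix (Fin (n i)) (Fin (r i)) ℝ)
    (U : ∀ j, Matrix (Fin (r j)) (Fin (s j)) ℝ) (K : Matrix (Fin (r i)) (Fin (s i)) ℝ) :
    (fun j => Function.update V i A j * Function.update U i K j) =
      Function.update (fun j => V j * U j) i (A * K) := by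
  funext j
  rcases eq_or_ne j i with rfl | hj
  · simp
  · simp [hj]

theorem transpose_update_eq_update {d : ℕ} {n r : Fin d → ℕ} (i : Fin d)
    (V : ∀ j, Matrix (Fin (n j)) (Fin (r j)) ℝ) (A : Matrix (Fin (n i)) (Fin (r i)) ℝ) :
    (fun j => (Function.update V i A j)ᵀ) = Function.update (fun j => (V j)ᵀ) i Aᵀ := by
  funext j
  rcases eq_or_ne j i with rfl | hj
  · simp
  · simp [hj]

/-- The mode product `W ×ᵢ A` with a square matrix `A`. -/
def modeMul {d : ℕ} {n : Fin d → ℕ} (i : Fin d) (A : Matrix (Fin (n i)) (Fin (n i)) ℝ)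
    (W : Tensor n) : Tensor n :=
  tucker W (Function.update (fun _ => 1) i A)

theorem modeMul_tucker {d : ℕ} {n r : Fin d → ℕ} (i : Fin d)
    (A : Matrix (Fin (n i)) (Fin (n i)) ℝ) (C : Tensor r)
    (U : ∀ j, Matrix (Fin (n j)) (Fin (r j)) ℝ) :
    modeMul i A (tucker C U) = tucker C (Function.update U i (A * U i)) := by
  rw [modeMul, tucker_tucker]
  conv_lhs => rw [← Function.update_eq_self i U]
  rw [mul_update_eq_update]
  simp

theorem modeMul_tucker_update {d : ℕ} {n r : Fin d → ℕ} (i : Fin d)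
    (A : Matrix (Fin (n i)) (Fin (n i)) ℝ) (C : Tensor r)
    (U : ∀ j, Matrix (Fin (n j)) (Fin (r j)) ℝ) (K : Matrix (Fin (n i)) (Fin (r i)) ℝ) :
    modeMul i A (tucker C (Function.update U i K)) = tucker C (Function.update U i (A * K)) := by
  rw [modeMul_tucker, Function.update_self, Function.update_idem]

theorem modeMul_tucker_eq_zero {d : ℕ} {n r : Fin d → ℕ} (i : Fin d)
    (A : Matrix (Fin (n i)) (Fin (n i)) ℝ) (C : Tensor r)
    (U : ∀ j, Matrix (Fin (n j)) (Fin (r j)) ℝ) (h : A * U i = 0) :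
    modeMul i A (tucker C U) = 0 := by
  rw [modeMul_tucker, h, tucker_update_zero]

theorem modeMul_sub {d : ℕ} {n : Fin d → ℕ} (i : Fin d)
    (A : Matrix (Fin (n i)) (Fin (n i)) ℝ) (V W : Tensor n) :
    modeMul i A (V - W) = modeMul i A V - modeMul i A W :=
  tucker_sub _ _ _

theorem modeMul_one_sub {d : ℕ} {n : Fin d → ℕ} (i : Fin d)
    (A : Matrix (Fin (n i)) (Fin (n i)) ℝ) (W : Tensor n) :
    modeMul i (1 - A) W = W - modeMul i A W := by
  have h := tucker_update_add W (fun _ => 1) i (1 - A) A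
  have h1 : Function.update (fun j => (1 : Matrix (Fin (n j)) (Fin (n j)) ℝ)) i 1 = fun _ => 1 :=
    Function.update_eq_self i _
  rw [sub_add_cancel, h1, tucker_one] at h
  exact eq_sub_of_add_eq h.symm

theorem inner_modeMul_left {d : ℕ} {n : Fin d → ℕ} (i : Fin d)
    (A : Matrix (Fin (n i)) (Fin (n i)) ℝ) (V W : Tensor n) :
    inner ℝ (modeMul i A V) W = inner ℝ V (modeMul i Aᵀ W) := by
  rw [modeMul, inner_tucker_left, transpose_update_eq_update]
  simp [modeMul]

theorem norm_modeMul_le_of_projection {d : ℕ} {n : Fin d → ℕ} (i : Fin d)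
    (A : Matrix (Fin (n i)) (Fin (n i)) ℝ) (hT : Aᵀ = A) (hA : A * A = A) (W : Tensor n) :
    ‖modeMul i A W‖ ≤ ‖W‖ := by
  refine norm_tucker_le_of_projection W _ (fun j => ?_) fun j => ?_
  · rcases eq_or_ne j i with rfl | hj
    · simpa using hT
    · simp [hj]
  · rcases eq_or_ne j i with rfl | hj
    · simpa using hA
    · simp [hj]

/-- The defect of a projection in all modes is bounded by the sum of the defects mode by mode. -/
theorem norm_sub_tucker_le_sum {d : ℕ} {n : Fin d → ℕ} (W : Tensor n)
    (A : ∀ i, Matrix (Fin (n i)) (Fin (n i)) ℝ) (hT : ∀ i, (A i)ᵀ = A i)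
    (hA : ∀ i, A i * A i = A i) :
    ‖W - tucker W A‖ ≤ ∑ j, ‖modeMul j (1 - A j) W‖ := by
  classical
  have key : ∀ t : Finset (Fin d), ‖W - tucker W (fun i => if i ∈ t then A i else 1)‖ ≤
      ∑ j ∈ t, ‖modeMul j (1 - A j) W‖ := by
    intro t
    induction t using Finset.induction_on with
    | empty => simp [tucker_one]
    | insert j t hj ih =>
      have hc : tucker W (fun i => if i ∈ insert j t then A i else 1) =
          tucker (modeMul j (A j) W) (fun i => if i ∈ t then A i else 1) := by
        rw [modeMul, tucker_tucker]
        congr 1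
        funext i
        rcases eq_or_ne i j with rfl | hi
        · simp [hj]
        · simp [hi]
      have hs : W - tucker W (fun i => if i ∈ insert j t then A i else 1) =
          tucker (modeMul j (1 - A j) W) (fun i => if i ∈ t then A i else 1) +
            (W - tucker W (fun i => if i ∈ t then A i else 1)) := by
        rw [hc, modeMul_one_sub, tucker_sub]
        abel
      rw [hs, Finset.sum_insert hj]
      refine (norm_add_le _ _).trans (add_le_add (norm_tucker_le_of_projection _ _ ?_ ?_) ih)
      · intro i
        split_ifs <;> simp [hT]
      · intro i
        split_ifs <;> simp [hA]
  simpa using key Finset.univ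

/-! ### Unfoldings -/

theorem unfoldMode_apply {d : ℕ} {n : Fin d → ℕ} (i : Fin d) (W : Tensor n) (x : ∀ j, Fin (n j)) :
    unfoldMode i W (x i) (fun j => x j) = W x := by
  have h := (Equiv.piSplitAt i (fun j => Fin (n j))).symm_apply_apply x
  exact congrArg W h

theorem foldMode_unfoldMode {d : ℕ} {n : Fin d → ℕ} (i : Fin d) (W : Tensor n) :
    foldMode i (unfoldMode i W) = W := by
  ext x
  exact unfoldMode_apply i W x

theorem piSplitAt_symm_self {d : ℕ} {n : Fin d → ℕ} (i : Fin d) (a : Fin (n i))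
    (b : ∀ j : {j // j ≠ i}, Fin (n j)) :
    (Equiv.piSplitAt i (fun j => Fin (n j))).symm (a, b) i = a := by
  simp [Equiv.piSplitAt]

theorem piSplitAt_symm_of_ne {d : ℕ} {n : Fin d → ℕ} (i : Fin d) (a : Fin (n i))
    (b : ∀ j : {j // j ≠ i}, Fin (n j)) (j : {j // j ≠ i}) :
    (Equiv.piSplitAt i (fun j => Fin (n j))).symm (a, b) j = b j := by
  simp [Equiv.piSplitAt, j.2]

theorem unfoldMode_foldMode {d : ℕ} {n : Fin d → ℕ} (i : Fin d)
    (A : Matrix (Fin (n i)) (∀ j : {j // j ≠ i}, Fin (n j)) ℝ) :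
    unfoldMode i (foldMode i A) = A := by
  ext a b
  change A _ _ = A a b
  rw [piSplitAt_symm_self]
  congr 1
  funext j
  exact piSplitAt_symm_of_ne i a b j

/-- The transpose of the Kronecker product of all factors `Uⱼ` with `j ≠ i`. -/
def kroneckerTranspose {d : ℕ} {n r : Fin d → ℕ} (i : Fin d)
    (U : ∀ j, Matrix (Fin (n j)) (Fin (r j)) ℝ) :
    Matrix (∀ j : {j // j ≠ i}, Fin (r j)) (∀ j : {j // j ≠ i}, Fin (n j)) ℝ :=
  Matrix.of fun c b => ∏ j : {j // j ≠ i}, U j (b j) (c j)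

theorem unfoldMode_tucker {d : ℕ} {n r : Fin d → ℕ} (i : Fin d) (C : Tensor r)
    (U : ∀ j, Matrix (Fin (n j)) (Fin (r j)) ℝ) :
    unfoldMode i (tucker C U) = U i * unfoldMode i C * kroneckerTranspose i U := by
  ext a b
  change tucker C U _ = _
  rw [tucker_apply, ← (Equiv.piSplitAt i (fun j => Fin (r j))).symm.sum_comp, Fintype.sum_prod_type]
  simp only [Matrix.mul_apply, Finset.sum_mul]
  rw [Finset.sum_comm]
  refine Finset.sum_congr rfl fun c _ => Finset.sum_congr rfl fun a' _ => ?_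
  have hp : ∏ j, U j ((Equiv.piSplitAt i (fun j => Fin (n j))).symm (a, b) j)
      ((Equiv.piSplitAt i (fun j => Fin (r j))).symm (a', c) j) =
      U i a a' * ∏ j : {j // j ≠ i}, U j (b j) (c j) := by
    rw [Fintype.prod_eq_mul_prod_subtype_ne _ i, piSplitAt_symm_self, piSplitAt_symm_self]
    congr 1
    refine Finset.prod_congr rfl fun j _ => ?_
    rw [piSplitAt_symm_of_ne, piSplitAt_symm_of_ne]
  rw [hp]
  simp only [unfoldMode, kroneckerTranspose, Matrix.of_apply]
  ring

theorem rank_unfoldMode_tucker_le {d : ℕ} {n r : Fin d → ℕ} (i : Fin d) (C : Tensor r)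
    (U : ∀ j, Matrix (Fin (n j)) (Fin (r j)) ℝ) :
    (unfoldMode i (tucker C U)).rank ≤ (unfoldMode i C).rank := by
  rw [unfoldMode_tucker]
  exact (Matrix.rank_mul_le_left _ _).trans (Matrix.rank_mul_le_right _ _)

theorem tucker_mem_tuckerManifold {d : ℕ} {n r ρ : Fin d → ℕ} {C : Tensor r}
    (hC : C ∈ tuckerManifold r ρ) {U : ∀ j, Matrix (Fin (n j)) (Fin (r j)) ℝ}
    (hU : ∀ j, (U j)ᵀ * U j = 1) : tucker C U ∈ tuckerManifold n ρ := by
  intro i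
  refine le_antisymm ((rank_unfoldMode_tucker_le i C U).trans_eq (hC i)) ?_
  have h : tucker (tucker C U) (fun j => (U j)ᵀ) = C := by
    rw [tucker_tucker]
    simp only [hU, tucker_one]
  rw [← hC i]
  nth_rewrite 1 [← h]
  exact rank_unfoldMode_tucker_le i _ _

theorem modeMul_foldMode {d : ℕ} {n : Fin d → ℕ} (i : Fin d)
    (A : Matrix (Fin (n i)) (Fin (n i)) ℝ)
    (M : Matrix (Fin (n i)) (∀ j : {j // j ≠ i}, Fin (n j)) ℝ) :
    modeMul i A (foldMode i M) = foldMode i (A * M) := by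
  rw [← foldMode_unfoldMode i (modeMul i A (foldMode i M)), modeMul, unfoldMode_tucker,
    unfoldMode_foldMode, Function.update_self]
  congr 1
  suffices hone : kroneckerTranspose i (Function.update
      (fun j => (1 : Matrix (Fin (n j)) (Fin (n j)) ℝ)) i A) = 1 by
    rw [hone, Matrix.mul_one]
  ext c b
  have hp : ∀ j : {j // j ≠ i}, (Function.update (fun j => (1 : Matrix (Fin (n j)) (Fin (n j)) ℝ))
      i A j : Matrix (Fin (n j)) (Fin (n j)) ℝ) = 1 := fun j => Function.update_of_ne j.2 _ _
  simp only [kroneckerTranspose, Matrix.of_apply, hp]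
  rcases eq_or_ne c b with rfl | hcb
  · simp
  · obtain ⟨j, hj⟩ := Function.ne_iff.1 hcb
    rw [Matrix.one_apply_ne hcb]
    exact Finset.prod_eq_zero (Finset.mem_univ j) (Matrix.one_apply_ne (fun h => hj h.symm))

theorem inner_foldMode {d : ℕ} {n : Fin d → ℕ} (i : Fin d)
    (M N : Matrix (Fin (n i)) (∀ j : {j // j ≠ i}, Fin (n j)) ℝ) :
    inner ℝ (foldMode i M) (foldMode i N) = (Mᵀ * N).trace := by
  simp only [PiLp.inner_apply, RCLike.inner_apply, conj_trivial, Matrix.trace, Matrix.diag,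
    Matrix.mul_apply, Matrix.transpose_apply]
  rw [← (Equiv.piSplitAt i (fun j => Fin (n j))).symm.sum_comp, Fintype.sum_prod_type,
    Finset.sum_comm]
  refine Finset.sum_congr rfl fun b _ => Finset.sum_congr rfl fun a _ => ?_
  have h : ∀ M : Matrix (Fin (n i)) (∀ j : {j // j ≠ i}, Fin (n j)) ℝ,
      foldMode i M ((Equiv.piSplitAt i (fun j => Fin (n j))).symm (a, b)) = M a b := fun M =>
    congrFun (congrFun (unfoldMode_foldMode i M) a) b
  rw [h, h, mul_comm]

/-- The chart `K ↦ Ten_i(Qᵀ) ×_{j≠i} Uⱼ ×ᵢ K` used for the update of the `i`-th factor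
preserves the Frobenius norm. -/
theorem norm_tucker_foldMode_update {d : ℕ} {n r : Fin d → ℕ} (i : Fin d)
    (Q : Matrix (∀ j : {j // j ≠ i}, Fin (r j)) (Fin (r i)) ℝ) (hQ : Qᵀ * Q = 1)
    (U : ∀ j, Matrix (Fin (n j)) (Fin (r j)) ℝ) (hU : ∀ j, (U j)ᵀ * U j = 1)
    (K : FrobMatrix (n i) (r i)) :
    ‖tucker (foldMode i Qᵀ) (Function.update U i K.toMatrix)‖ = ‖K‖ := by
  have h : inner ℝ (tucker (foldMode i Qᵀ) (Function.update U i K.toMatrix))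
      (tucker (foldMode i Qᵀ) (Function.update U i K.toMatrix)) = inner ℝ K K := by
    have hupd : (fun j => (Function.update U i K.toMatrix j)ᵀ * Function.update U i K.toMatrix j) =
        Function.update (fun j => (1 : Matrix (Fin (r j)) (Fin (r j)) ℝ)) i
          (K.toMatrixᵀ * K.toMatrix) := by
      funext j
      rcases eq_or_ne j i with rfl | hj
      · simp
      · simp [hj, hU]
    rw [inner_tucker_left, tucker_tucker, hupd, ← modeMul, modeMul_foldMode, inner_foldMode,
      Matrix.transpose_transpose, ← Matrix.mul_assoc,
      Matrix.trace_mul_comm, ← Matrix.mul_assoc, hQ, Matrix.one_mul]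
    simp only [PiLp.inner_apply, RCLike.inner_apply, conj_trivial, Matrix.trace, Matrix.diag,
      Matrix.mul_apply, Matrix.transpose_apply, FrobMatrix.toMatrix, Matrix.of_apply]
    rw [Fintype.sum_prod_type, Finset.sum_comm]
  rw [real_inner_self_eq_norm_sq, real_inner_self_eq_norm_sq] at h
  exact (sq_eq_sq₀ (norm_nonneg _) (norm_nonneg _)).1 h

/-- The chart `K ↦ Ten_i(Qᵀ) ×_{j≠i} Uⱼ ×ᵢ K` as an isometry. -/
def basisIsometry {d : ℕ} {n r : Fin d → ℕ} (i : Fin d)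
    (Q : Matrix (∀ j : {j // j ≠ i}, Fin (r j)) (Fin (r i)) ℝ) (hQ : Qᵀ * Q = 1)
    (U : ∀ j, Matrix (Fin (n j)) (Fin (r j)) ℝ) (hU : ∀ j, (U j)ᵀ * U j = 1) :
    FrobMatrix (n i) (r i) →ₗᵢ[ℝ] Tensor n where
  toFun K := tucker (foldMode i Qᵀ) (Function.update U i K.toMatrix)
  map_add' K K' := tucker_update_add _ U i K.toMatrix K'.toMatrix
  map_smul' c K := tucker_update_smul _ U i c K.toMatrix
  norm_map' K := norm_tucker_foldMode_update i Q hQ U hU K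

/-! ### Ranges and projections -/

theorem mul_eq_zero_of_range_le {m p q : Type*} {l : Type*} [Fintype m] [Fintype p] [Fintype q]
    (E : Matrix l m ℝ) (A : Matrix m p ℝ) (M : Matrix m q ℝ)
    (h : LinearMap.range M.mulVecLin ≤ LinearMap.range A.mulVecLin) (hA : E * A = 0) :
    E * M = 0 := by
  classical
  refine Matrix.ext_of_mulVec_single fun j => ?_
  obtain ⟨w, hw⟩ := h ⟨Pi.single j 1, rfl⟩
  rw [Matrix.mulVecLin_apply, Matrix.mulVecLin_apply] at hw
  rw [← Matrix.mulVec_mulVec, ← hw, Matrix.mulVec_mulVec, hA, Matrix.zero_mulVec,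
    Matrix.zero_mulVec]

theorem one_sub_mul_self_eq_zero {p q : ℕ} {B : Matrix (Fin p) (Fin q) ℝ} (hB : Bᵀ * B = 1) :
    (1 - B * Bᵀ) * B = 0 := by
  rw [Matrix.sub_mul, Matrix.one_mul, Matrix.mul_assoc, hB, Matrix.mul_one, sub_self]

theorem range_left_le_range_fromCols {m p q : Type*} [Fintype p] [Fintype q]
    (K : Matrix m p ℝ) (U : Matrix m q ℝ) :
    LinearMap.range K.mulVecLin ≤ LinearMap.range (Matrix.fromCols K U).mulVecLin := by
  rintro _ ⟨v, rfl⟩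
  exact ⟨Sum.elim v 0, by simp [Matrix.fromCols_mulVec]⟩

theorem range_right_le_range_fromCols {m p q : Type*} [Fintype p] [Fintype q]
    (K : Matrix m p ℝ) (U : Matrix m q ℝ) :
    LinearMap.range U.mulVecLin ≤ LinearMap.range (Matrix.fromCols K U).mulVecLin := by
  rintro _ ⟨v, rfl⟩
  exact ⟨Sum.elim 0 v, by simp [Matrix.fromCols_mulVec]⟩

theorem IsOrthonormalRangeBasis.one_sub_mul_eq_zero {p q s : ℕ}
    {K U : Matrix (Fin p) (Fin q) ℝ} {B : Matrix (Fin p) (Fin s) ℝ}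
    (h : IsOrthonormalRangeBasis K U B) : (1 - B * Bᵀ) * K = 0 ∧ (1 - B * Bᵀ) * U = 0 :=
  ⟨mul_eq_zero_of_range_le _ B K ((range_left_le_range_fromCols K U).trans_eq h.2.symm)
      (one_sub_mul_self_eq_zero h.1),
    mul_eq_zero_of_range_le _ B U ((range_right_le_range_fromCols K U).trans_eq h.2.symm)
      (one_sub_mul_self_eq_zero h.1)⟩

/-- If `Y = C ×ⱼ Uⱼ` has full rank `ρᵢ` in mode `i`, the range of `Uᵢ` is that of `Mat_i(Y)`, so a
matrix that annihilates `Mat_i(Y)` annihilates `Uᵢ`. -/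
theorem mul_basis_eq_zero_of_mul_unfoldMode_eq_zero {d : ℕ} {n ρ : Fin d → ℕ} {i : Fin d}
    {C : Tensor ρ} {U : ∀ j, Matrix (Fin (n j)) (Fin (ρ j)) ℝ}
    (hr : (unfoldMode i (tucker C U)).rank = ρ i) (E : Matrix (Fin (n i)) (Fin (n i)) ℝ)
    (hE : E * unfoldMode i (tucker C U) = 0) : E * U i = 0 := by
  have hle : LinearMap.range (unfoldMode i (tucker C U)).mulVecLin ≤
      LinearMap.range (U i).mulVecLin := by
    rw [unfoldMode_tucker, Matrix.mul_assoc, Matrix.mulVecLin_mul]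
    exact LinearMap.range_comp_le_range _ _
  have hrank : (U i).rank ≤ (unfoldMode i (tucker C U)).rank := by
    rw [hr]
    simpa using Matrix.rank_le_width (U i)
  have heq := Submodule.eq_of_le_of_finrank_le hle hrank
  exact mul_eq_zero_of_range_le E _ (U i) heq.ge hE

/-! ### Gradient flows restricted to an isometric chart -/

theorem gradient_comp_isometry {E F : Type*} [NormedAddCommGroup E] [InnerProductSpace ℝ E]
    [CompleteSpace E] [NormedAddCommGroup F] [InnerProductSpace ℝ F] [CompleteSpace F]
    (f : F → ℝ) (ι : E →ₗᵢ[ℝ] F) (x : E) (hf : DifferentiableAt ℝ f (ι x)) :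
    gradient (fun y => f (ι y)) x = ι.toContinuousLinearMap.adjoint (gradient f (ι x)) := by
  refine HasGradientAt.gradient ?_
  rw [hasGradientAt_iff_hasFDerivAt]
  refine (hf.hasGradientAt.hasFDerivAt.comp x ι.toContinuousLinearMap.hasFDerivAt).congr_fderiv ?_
  ext v
  simp [ContinuousLinearMap.adjoint_inner_left]

theorem norm_adjoint_isometry_le {E F : Type*} [NormedAddCommGroup E] [InnerProductSpace ℝ E]
    [CompleteSpace E] [NormedAddCommGroup F] [InnerProductSpace ℝ F] [CompleteSpace F]
    (ι : E →ₗᵢ[ℝ] F) (v : F) : ‖ι.toContinuousLinearMap.adjoint v‖ ≤ ‖v‖ := by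
  refine (ContinuousLinearMap.le_opNorm _ v).trans ?_
  rw [LinearIsometryEquiv.norm_map]
  exact mul_le_of_le_one_left (norm_nonneg v) ι.norm_toContinuousLinearMap_le

/-- On the ball `B(c, δ)` the function `f` is differentiable, with gradient of norm less than `M` and
Lipschitz continuous with constant `L`. -/
structure GradientBoundedOnBall {F : Type*} [NormedAddCommGroup F] [InnerProductSpace ℝ F]
    [CompleteSpace F] (f : F → ℝ) (c : F) (δ M L : ℝ) : Prop where
  differentiableAt : ∀ y ∈ Metric.ball c δ, DifferentiableAt ℝ f y
  norm_gradient_lt : ∀ y ∈ Metric.ball c δ, ‖gradient f y‖ < M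
  norm_gradient_sub_le : ∀ y ∈ Metric.ball c δ, ∀ z ∈ Metric.ball c δ,
    ‖gradient f y - gradient f z‖ ≤ L * ‖y - z‖

/-- The flow of `f ∘ ι` cannot leave the ball before it has covered the distance to its boundary. -/
theorem GradientBoundedOnBall.norm_flow_sub_le {E F : Type*} [NormedAddCommGroup E]
    [InnerProductSpace ℝ E] [CompleteSpace E] [NormedAddCommGroup F] [InnerProductSpace ℝ F]
    [CompleteSpace F] {f : F → ℝ} {c : F} {δ M L : ℝ} (hf : GradientBoundedOnBall f c δ M L)
    (hM : 0 ≤ M) (ι : E →ₗᵢ[ℝ] F) {h : ℝ} {x : ℝ → E}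
    (hx : IsGradientFlow (fun y => f (ι y)) h x) (hδ : ‖c - ι (x 0)‖ + M * h < δ) :
    ∀ t ∈ Set.Icc 0 h, ‖x t - x 0‖ ≤ M * t := by
  refine image_norm_le_of_norm_deriv_right_lt_deriv_boundary'
    (f' := fun t => -gradient (fun y => f (ι y)) (x t)) (B' := fun _ => M) ?_ ?_ ?_ ?_ ?_ ?_
  · exact fun t ht => ((hx t ht).sub_const _).continuousWithinAt
  · intro t ht
    exact ((hx t ⟨ht.1, ht.2.le⟩).sub_const _).mono_of_mem_nhdsWithin (Icc_mem_nhdsGE_of_mem ht)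
  · simp
  · fun_prop
  · intro t _
    simpa using ((hasDerivAt_id t).const_mul M).hasDerivWithinAt
  · intro t ht hxt
    have hball : ι (x t) ∈ Metric.ball c δ := by
      rw [mem_ball_iff_norm]
      have h1 : ι (x t) - c = ι (x t - x 0) - (c - ι (x 0)) := by
        rw [map_sub]
        abel
      have h2 := norm_sub_le (ι (x t - x 0)) (c - ι (x 0))
      rw [h1]
      rw [ι.norm_map, hxt] at h2
      have h3 := mul_le_mul_of_nonneg_left ht.2.le hM
      linarith
    rw [norm_neg, gradient_comp_isometry f ι _ (hf.differentiableAt _ hball)]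
    exact (norm_adjoint_isometry_le ι _).trans_lt (hf.norm_gradient_lt _ hball)

/-- Local error of the explicit Euler step for the flow of `f ∘ ι`. -/
theorem GradientBoundedOnBall.norm_flow_sub_euler_le {E F : Type*} [NormedAddCommGroup E]
    [InnerProductSpace ℝ E] [CompleteSpace E] [NormedAddCommGroup F] [InnerProductSpace ℝ F]
    [CompleteSpace F] {f : F → ℝ} {c : F} {δ M L : ℝ} (hf : GradientBoundedOnBall f c δ M L)
    (hM : 0 ≤ M) (hL : 0 ≤ L) (ι : E →ₗᵢ[ℝ] F) {h : ℝ} (hh : 0 ≤ h) {x : ℝ → E}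
    (hx : IsGradientFlow (fun y => f (ι y)) h x) (hδ : ‖c - ι (x 0)‖ + M * h < δ) :
    ‖x h - x 0 + h • ι.toContinuousLinearMap.adjoint (gradient f (ι (x 0)))‖ ≤ L * (M * h) * h := by
  have hdist := hf.norm_flow_sub_le hM ι hx hδ
  have hball : ∀ t ∈ Set.Icc 0 h, ι (x t) ∈ Metric.ball c δ := by
    intro t ht
    rw [mem_ball_iff_norm]
    have h1 : ι (x t) - c = ι (x t - x 0) - (c - ι (x 0)) := by
      rw [map_sub]
      abel
    have h2 := norm_sub_le (ι (x t - x 0)) (c - ι (x 0))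
    rw [h1]
    rw [ι.norm_map] at h2
    have h3 := mul_le_mul_of_nonneg_left ht.2 hM
    linarith [hdist t ht]
  have h0 : (0 : ℝ) ∈ Set.Icc 0 h := ⟨le_rfl, hh⟩
  have key := norm_image_sub_le_of_norm_deriv_le_segment'
    (f := fun t => x t - x 0 + t • ι.toContinuousLinearMap.adjoint (gradient f (ι (x 0))))
    (f' := fun t => -gradient (fun y => f (ι y)) (x t) +
      ι.toContinuousLinearMap.adjoint (gradient f (ι (x 0)))) (a := 0) (b := h)
    (C := L * (M * h)) ?_ ?_ h ⟨hh, le_rfl⟩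
  · simpa using key
  · intro t ht
    refine ((hx t ht).sub_const _).add ?_
    simpa using ((hasDerivAt_id t).smul_const
      (ι.toContinuousLinearMap.adjoint (gradient f (ι (x 0))))).hasDerivWithinAt
  · intro t ht
    have ht' : t ∈ Set.Icc 0 h := ⟨ht.1, ht.2.le⟩
    rw [gradient_comp_isometry f ι _ (hf.differentiableAt _ (hball t ht')), neg_add_eq_sub,
      ← map_sub]
    refine (norm_adjoint_isometry_le ι _).trans
      ((hf.norm_gradient_sub_le _ (hball 0 h0) _ (hball t ht')).trans ?_)
    refine mul_le_mul_of_nonneg_left ?_ hL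
    rw [← map_sub, ι.norm_map, norm_sub_rev]
    exact (hdist t ht').trans (mul_le_mul_of_nonneg_left ht.2.le hM)

/-! ### One step of the algorithm -/

theorem tucker_update_mul {d : ℕ} {n r : Fin d → ℕ} (i : Fin d) (C : Tensor r)
    (U : ∀ j, Matrix (Fin (n j)) (Fin (r j)) ℝ) (S : Matrix (Fin (r i)) (Fin (r i)) ℝ) :
    tucker C (Function.update U i (U i * S)) = tucker (modeMul i S C) U := by
  rw [modeMul, tucker_tucker]
  conv_rhs =>
    enter [2, j]
    rw [← Function.update_eq_self i U]
  rw [mul_update_eq_update]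
  simp

/-- The flow of the `i`-th basis matrix starts at the current tensor. -/
theorem tucker_foldMode_update_of_isQR {d : ℕ} {n r : Fin d → ℕ} (i : Fin d) (C : Tensor r)
    (U : ∀ j, Matrix (Fin (n j)) (Fin (r j)) ℝ)
    {Q : Matrix (∀ j : {j // j ≠ i}, Fin (r j)) (Fin (r i)) ℝ}
    {S : Matrix (Fin (r i)) (Fin (r i)) ℝ} (hQS : IsQR (unfoldMode i C)ᵀ Q Sᵀ) :
    tucker (foldMode i Qᵀ) (Function.update U i (U i * S)) = tucker C U := by
  have h : S * Qᵀ = unfoldMode i C := by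
    rw [← Matrix.transpose_transpose (unfoldMode i C), hQS.1, Matrix.transpose_mul,
      Matrix.transpose_transpose]
  rw [tucker_update_mul, modeMul_foldMode, h, foldMode_unfoldMode]

/-- If a projection in mode `i` fixes the tensor `Y` of Tucker rank `ρ`, then the part of a tangent
vector at `Y` that it removes is `Y ×ᵢ G` for a matrix `G`: only the variation of the `i`-th factor
contributes. The singular values of the unfoldings of `Y` play no role. -/
theorem exists_modeMul_tangent_eq {d : ℕ} {n ρ : Fin d → ℕ} (i : Fin d) {Y Z : Tensor n}
    (hY : Y ∈ tuckerManifold n ρ) (hZ : Z ∈ tuckerTangent ρ Y)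
    (E : Matrix (Fin (n i)) (Fin (n i)) ℝ) (hE : E * unfoldMode i Y = 0) :
    ∃ G : Matrix (Fin (n i)) (Fin (n i)) ℝ, modeMul i E Z = modeMul i G Y := by
  obtain ⟨C, U, hU, rfl, δC, δU, -, rfl⟩ := hZ
  have hEU : E * U i = 0 := mul_basis_eq_zero_of_mul_unfoldMode_eq_zero (hY i) E hE
  refine ⟨E * δU i * (U i)ᵀ, ?_⟩
  rw [modeMul, tucker_add, tucker_sum, ← modeMul, modeMul_tucker_eq_zero i E δC U hEU, zero_add,
    Finset.sum_eq_single i]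
  · rw [← modeMul, modeMul_tucker_update, modeMul_tucker, Matrix.mul_assoc _ _ (U i), hU,
      Matrix.mul_one]
  · intro j _ hj
    exact modeMul_tucker_eq_zero i E C _ (by rwa [Function.update_of_ne hj.symm])
  · simp

theorem one_sub_mul_transpose_isSymm {p q : ℕ} (B : Matrix (Fin p) (Fin q) ℝ) :
    (1 - B * Bᵀ)ᵀ = 1 - B * Bᵀ := by
  simp

theorem mul_transpose_idempotent {p q : ℕ} {B : Matrix (Fin p) (Fin q) ℝ} (hB : Bᵀ * B = 1) :
    B * Bᵀ * (B * Bᵀ) = B * Bᵀ := by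
  rw [Matrix.mul_assoc, ← Matrix.mul_assoc Bᵀ, hB, Matrix.one_mul]

theorem one_sub_mul_transpose_idempotent {p q : ℕ} {B : Matrix (Fin p) (Fin q) ℝ}
    (hB : Bᵀ * B = 1) : (1 - B * Bᵀ) * (1 - B * Bᵀ) = 1 - B * Bᵀ := by
  rw [Matrix.mul_sub, Matrix.mul_one, ← Matrix.mul_assoc, one_sub_mul_self_eq_zero hB,
    Matrix.zero_mul, sub_zero]

theorem TuckerFactors.IsProper.toTensor_mem {d : ℕ} {n : Fin d → ℕ} {X : TuckerFactors n}
    (hX : X.IsProper) : X.toTensor ∈ tuckerManifold n X.rank :=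
  tucker_mem_tuckerManifold hX.2 hX.1

theorem IsBasisUpdate.orthonormal {d : ℕ} {n : Fin d → ℕ} {𝓛 : Tensor n → ℝ} {h : ℝ}
    {X : TuckerFactors n} {i : Fin d} {s : ℕ} {B : Matrix (Fin (n i)) (Fin s) ℝ}
    (hB : IsBasisUpdate 𝓛 h X i B) : Bᵀ * B = 1 := by
  obtain ⟨_, _, _, _, _, _, hB⟩ := hB
  exact hB.1

theorem IsBasisUpdate.one_sub_mul_basis {d : ℕ} {n : Fin d → ℕ} {𝓛 : Tensor n → ℝ} {h : ℝ}
    {X : TuckerFactors n} {i : Fin d} {s : ℕ} {B : Matrix (Fin (n i)) (Fin s) ℝ}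
    (hB : IsBasisUpdate 𝓛 h X i B) : (1 - B * Bᵀ) * X.basis i = 0 := by
  obtain ⟨_, _, _, _, _, _, hB⟩ := hB
  exact hB.one_sub_mul_eq_zero.2

/-- The new `i`-th basis captures the negative gradient up to `2ε + L M h`. -/
theorem IsBasisUpdate.norm_modeMul_gradient_le {d : ℕ} {n : Fin d → ℕ} {𝓛 : Tensor n → ℝ} {h : ℝ}
    {X : TuckerFactors n} {i : Fin d} {s : ℕ} {B : Matrix (Fin (n i)) (Fin s) ℝ}
    (hB : IsBasisUpdate 𝓛 h X i B) (hX : X.IsProper) (hh : 0 < h) {c : Tensor n} {δ M L ε : ℝ}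
    (hf : GradientBoundedOnBall 𝓛 c δ M L) (hM : 0 ≤ M) (hL : 0 ≤ L)
    (hδ : ‖c - X.toTensor‖ + M * h < δ) {Z : Tensor n}
    (hZ : Z ∈ tuckerTangent X.rank X.toTensor) (hZε : ‖-gradient 𝓛 X.toTensor - Z‖ ≤ ε) :
    ‖modeMul i (1 - B * Bᵀ) (-gradient 𝓛 X.toTensor)‖ ≤ 2 * ε + L * (M * h) := by
  have hEX := hB.one_sub_mul_basis
  obtain ⟨Q, S, K, hQS, hK0, hK, hrange⟩ := hB
  have hBB := hrange.1
  have hEK := hrange.one_sub_mul_eq_zero.1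
  set E := 1 - B * Bᵀ with hEdef
  have hET : Eᵀ = E := one_sub_mul_transpose_isSymm B
  have hEE : E * E = E := one_sub_mul_transpose_idempotent hBB
  let ι := basisIsometry i Q hQS.2.1 X.basis hX.1
  have hι : ∀ K' : FrobMatrix (n i) (X.rank i),
      ι K' = tucker (foldMode i Qᵀ) (Function.update X.basis i K'.toMatrix) := fun _ => rfl
  have hY : ι (K 0) = X.toTensor := by
    rw [hι, hK0]
    exact tucker_foldMode_update_of_isQR i X.core X.basis hQS
  have heuler := hf.norm_flow_sub_euler_le hM hL ι hh.le hK (by rwa [hY])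
  rw [hY] at heuler
  set g := gradient 𝓛 X.toTensor
  set D := modeMul i E Z with hD
  -- The removed part of `Z` lies in the range of the chart, in which `K` follows the flow.
  obtain ⟨dK, hdK⟩ : ∃ dK, D = ι dK := by
    have hEY : E * unfoldMode i X.toTensor = 0 := by
      rw [TuckerFactors.toTensor, unfoldMode_tucker, ← Matrix.mul_assoc, ← Matrix.mul_assoc, hEX,
        Matrix.zero_mul, Matrix.zero_mul]
    obtain ⟨G, hG⟩ := exists_modeMul_tangent_eq i hX.toTensor_mem hZ E hEY
    refine ⟨WithLp.toLp 2 fun p => (G * (K 0).toMatrix) p.1 p.2, ?_⟩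
    rw [hD, hG, ← hY, hι, modeMul_tucker_update, hι]
    rfl
  have hED : modeMul i E D = D := by
    rw [hD]
    change tucker (tucker _ _) _ = tucker _ _
    rw [tucker_tucker, mul_update_eq_update, hEE]
    simp
  have hEι : modeMul i E (ι (K h - K 0)) = 0 := by
    rw [map_sub, modeMul_sub, hY, hι, modeMul_tucker_update, hEK, tucker_update_zero,
      TuckerFactors.toTensor, modeMul_tucker_eq_zero i E _ _ hEX, sub_zero]
  have hself : ‖D‖ ^ 2 = inner ℝ Z D := by
    rw [← real_inner_self_eq_norm_sq]
    nth_rewrite 1 [hD]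
    rw [inner_modeMul_left, hET, hED]
  have hdisp : inner ℝ (K h - K 0) dK = 0 := by
    rw [← ι.inner_map_map, ← hdK, hD, real_inner_comm, inner_modeMul_left, hET, hEι,
      inner_zero_right]
  have hg : |inner ℝ g D| ≤ L * (M * h) * ‖D‖ := by
    have h1 : h * inner ℝ g D =
        inner ℝ (K h - K 0 + h • ι.toContinuousLinearMap.adjoint g) dK := by
      rw [inner_add_left, hdisp, zero_add, real_inner_smul_left,
        ContinuousLinearMap.adjoint_inner_left, hdK]
      rfl
    have h2 := abs_real_inner_le_norm (K h - K 0 + h • ι.toContinuousLinearMap.adjoint g) dK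
    rw [← h1, abs_mul, abs_of_pos hh, ← ι.norm_map dK, ← hdK] at h2
    have h3 := h2.trans (mul_le_mul_of_nonneg_right heuler (norm_nonneg D))
    refine le_of_mul_le_mul_left ?_ hh
    linarith
  have hDnorm : ‖D‖ ≤ ε + L * (M * h) := by
    have h1 : inner ℝ Z D = -inner ℝ (-g - Z) D - inner ℝ g D := by
      rw [inner_sub_left, inner_neg_left]
      ring
    have h2 := (abs_real_inner_le_norm (-g - Z) D).trans
      (mul_le_mul_of_nonneg_right hZε (norm_nonneg D))
    have h3 : ‖D‖ * ‖D‖ ≤ (ε + L * (M * h)) * ‖D‖ := by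
      linarith [neg_abs_le (inner ℝ (-g - Z) D), neg_abs_le (inner ℝ g D)]
    rcases (norm_nonneg D).eq_or_lt with h0 | h0
    · rw [← h0]
      have := (norm_nonneg _).trans hZε
      positivity
    · exact le_of_mul_le_mul_right h3 h0
  have hsplit : modeMul i E (-g) = modeMul i E (-g - Z) + D := by
    rw [modeMul_sub]
    abel
  rw [hsplit]
  refine (norm_add_le _ _).trans ?_
  linarith [norm_modeMul_le_of_projection i E hET hEE (-g - Z)]

/-- One step keeps the factors proper, increases the norm by at most `M h`, and deviates from an
explicit Euler step for the full gradient flow by the local error. -/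
theorem IsTDLRTStep.local_error {d : ℕ} {n : Fin d → ℕ} {𝓛 : Tensor n → ℝ} {h τ : ℝ}
    {X X' : TuckerFactors n} (hstep : IsTDLRTStep 𝓛 h τ X X') (hX : X.IsProper) (hh : 0 < h)
    (hτ : 0 ≤ τ) {c : Tensor n} {δ M L ε : ℝ}
    (hf : GradientBoundedOnBall 𝓛 c δ M L) (hM : 0 ≤ M) (hL : 0 ≤ L)
    (hδ : ‖c - X.toTensor‖ + M * h < δ) {Z : Tensor n}
    (hZ : Z ∈ tuckerTangent X.rank X.toTensor) (hZε : ‖-gradient 𝓛 X.toTensor - Z‖ ≤ ε) :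
    X'.IsProper ∧ ‖X'.toTensor‖ ≤ ‖X.toTensor‖ + M * h ∧
      ‖X.toTensor + h • (-gradient 𝓛 X.toTensor) - X'.toTensor‖ ≤
        h * (d * (2 * ε + L * (M * h))) + L * (M * h) * h + τ * (‖X.toTensor‖ + M * h) := by
  obtain ⟨s, B, C, V, hB, hC0, hC, ⟨hV, hcore, hfull, hround⟩, hbasis⟩ := hstep
  have hBB : ∀ i, (B i)ᵀ * B i = 1 := fun i => (hB i).orthonormal
  let ι := tuckerIsometry B hBB
  have hι : ∀ C', ι C' = tucker C' B := fun _ => rfl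
  have hY : ι (C 0) = X.toTensor := by
    rw [hι, hC0, tucker_tucker, TuckerFactors.toTensor]
    congr 1
    funext i
    have h1 := (hB i).one_sub_mul_basis
    rw [Matrix.sub_mul, Matrix.one_mul, sub_eq_zero] at h1
    rw [← Matrix.mul_assoc, ← h1]
  have hX' : X'.toTensor = ι (tucker X'.core V) := by
    rw [hι, tucker_tucker, TuckerFactors.toTensor]
    congr 1
    funext i
    exact hbasis i
  have hproper : X'.IsProper := by
    refine ⟨fun i => ?_, hfull⟩
    rw [hbasis, Matrix.transpose_mul, Matrix.mul_assoc, ← Matrix.mul_assoc (B i)ᵀ, hBB,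
      Matrix.one_mul, hV]
  have hdist := hf.norm_flow_sub_le hM ι hC (by rwa [hY]) h ⟨hh.le, le_rfl⟩
  have heuler := hf.norm_flow_sub_euler_le hM hL ι hh.le hC (by rwa [hY])
  rw [hY] at heuler
  have hCh : ‖C h‖ ≤ ‖X.toTensor‖ + M * h := by
    have h1 := norm_le_norm_add_norm_sub' (C h) (C 0)
    rw [← ι.norm_map (C 0), hY] at h1
    linarith
  refine ⟨hproper, ?_, ?_⟩
  · refine le_trans ?_ hCh
    rw [hX', ι.norm_map, norm_tucker_of_orthonormal _ _ hV, hcore, ← adjoint_tuckerIsometry V hV]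
    exact norm_adjoint_isometry_le _ _
  · set g := gradient 𝓛 X.toTensor
    have hP : tucker (-g) (fun i => B i * (B i)ᵀ) =
        -ι (ι.toContinuousLinearMap.adjoint g) := by
      rw [← map_neg, ← map_neg, adjoint_tuckerIsometry, hι, tucker_tucker]
    have hproj : ‖-g - tucker (-g) (fun i => B i * (B i)ᵀ)‖ ≤ d * (2 * ε + L * (M * h)) := by
      refine (norm_sub_tucker_le_sum _ _ (fun i => by simp)
        fun i => mul_transpose_idempotent (hBB i)).trans ?_
      refine (Finset.sum_le_card_nsmul _ _ _ fun i _ =>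
        (hB i).norm_modeMul_gradient_le hX hh hf hM hL hδ hZ hZε).trans_eq ?_
      simp [mul_add]
    have hsplit : X.toTensor + h • (-g) - X'.toTensor =
        h • (-g - tucker (-g) (fun i => B i * (B i)ᵀ)) -
          ι (C h - C 0 + h • ι.toContinuousLinearMap.adjoint g) +
          ι (C h - tucker X'.core V) := by
      rw [hP, hX', map_add, map_sub, map_sub, map_smul, hY, smul_sub, smul_neg h (ι _)]
      abel
    rw [hsplit]
    refine (norm_add_le _ _).trans (add_le_add ((norm_sub_le _ _).trans (add_le_add ?_ ?_)) ?_)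
    · rw [norm_smul, Real.norm_of_nonneg hh.le]
      exact mul_le_mul_of_nonneg_left hproj hh.le
    · rwa [ι.norm_map]
    · rw [ι.norm_map]
      exact hround.trans (mul_le_mul_of_nonneg_left hCh hτ)

/-! ### Error propagation -/

theorem IsGradientFlow.shift {E : Type*} [NormedAddCommGroup E] [InnerProductSpace ℝ E]
    [CompleteSpace E] {f : E → ℝ} {T a h : ℝ} {x : ℝ → E} (hx : IsGradientFlow f T x)
    (ha : 0 ≤ a) (hah : a + h ≤ T) : IsGradientFlow f h (fun t => x (a + t)) := by
  intro t ht
  have hmaps : Set.MapsTo (fun t => a + t) (Set.Icc 0 h) (Set.Icc 0 T) := fun u hu =>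
    ⟨by linarith [hu.1], by linarith [hu.2]⟩
  have h1 : HasDerivWithinAt (fun t => a + t) 1 (Set.Icc 0 h) t :=
    ((hasDerivAt_id t).const_add a).hasDerivWithinAt
  have h2 := (hx (a + t) (hmaps ht)).scomp t h1 hmaps
  rwa [one_smul] at h2

/-- Discrete Gronwall inequality for a recursion started at zero. -/
theorem le_pow_mul_of_le_one_add_mul_add {e a b : ℝ} {m : ℕ} {e' : ℝ} (ha : 0 ≤ a) (hb : 0 ≤ b)
    (hrec : e' ≤ (1 + a) * e + b) (he : e ≤ (1 + a) ^ m * (m * b)) :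
    e' ≤ (1 + a) ^ (m + 1) * ((m + 1 : ℕ) * b) := by
  have h1 : (1 : ℝ) ≤ (1 + a) ^ (m + 1) := one_le_pow₀ (by linarith)
  have h2 := mul_le_mul_of_nonneg_left he (by linarith : (0 : ℝ) ≤ 1 + a)
  have h3 := mul_le_mul_of_nonneg_right h1 hb
  push_cast
  calc e' ≤ (1 + a) * ((1 + a) ^ m * (m * b)) + 1 * b := by linarith
    _ ≤ (1 + a) * ((1 + a) ^ m * (m * b)) + (1 + a) ^ (m + 1) * b := by linarith
    _ = _ := by ring

theorem theorem3 (d : ℕ) (L₁ L₂ T : ℝ) :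
    ∃ c₁ c₂ : ℝ, 0 ≤ c₁ ∧ 0 ≤ c₂ ∧ ∀ R : ℝ, ∃ c₃ : ℝ, 0 ≤ c₃ ∧
      ∀ (n : Fin d → ℕ) (𝓛 : Tensor n → ℝ) (k : ℕ) (h τ ε δ : ℝ)
        (W : ℝ → Tensor n) (X : ℕ → TuckerFactors n),
        0 < h → 0 ≤ τ → 0 ≤ ε → 0 < δ → k * h ≤ T →
        -- the full gradient flow, and the run of the algorithm from the same initial tensor
        IsGradientFlow 𝓛 (k * h) W →
        ‖W 0‖ ≤ R →
        (X 0).IsProper →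
        (X 0).toTensor = W 0 →
        (∀ m < k, IsTDLRTStep 𝓛 h τ (X m) (X (m + 1))) →
        -- bounded and Lipschitz gradient around the exact trajectory
        (∀ t ∈ Set.Icc 0 (k * h), ∀ Y ∈ Metric.ball (W t) δ,
          DifferentiableAt ℝ 𝓛 Y ∧ ‖gradient 𝓛 Y‖ ≤ L₁) →
        (∀ t ∈ Set.Icc 0 (k * h), ∀ Y ∈ Metric.ball (W t) δ, ∀ Y' ∈ Metric.ball (W t) δ,
          ‖gradient 𝓛 Y - gradient 𝓛 Y'‖ ≤ L₂ * ‖Y - Y'‖) →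
        -- the negative gradient is `ε`-close to the tangent space at the current rank
        (∀ m < k, ∀ Y ∈ Metric.ball (W (m * h)) δ, Y ∈ tuckerManifold n (X m).rank →
          ∃ Z ∈ tuckerTangent (X m).rank Y, ‖-gradient 𝓛 Y - Z‖ ≤ ε) →
        c₁ * ε + c₂ * h + c₃ * τ / h ≤ δ →
        ‖W (k * h) - (X k).toTensor‖ ≤ c₁ * ε + c₂ * h + c₃ * τ / h := by
  -- `M` strictly exceeds the gradient norm, so that flows cannot reach the boundary of a ball.
  set M : ℝ := |L₁| + 1 with hMdef
  set L : ℝ := |L₂| with hLdef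
  have hM : 0 ≤ M := by positivity
  have hL : 0 ≤ L := abs_nonneg _
  set A : ℝ := Real.exp (L * |T|) * |T| with hA
  have hA0 : 0 ≤ A := by positivity
  -- The summand `M + 1` of `c₂` leaves room for one more step inside the ball of radius `δ`.
  refine ⟨A * (2 * d), A * ((d + 2) * (L * M)) + (M + 1), by positivity, by positivity,
    fun R => ⟨A * (|R| + M * |T|), by positivity, ?_⟩⟩
  intro n 𝓛 k h τ ε δ W X hh hτ hε hδ hkT hW hR hX0 hXW hstep hdiff hlip htan hbound
  have hball : ∀ m : ℕ, m ≤ k → GradientBoundedOnBall 𝓛 (W (m * h)) δ M L := by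
    intro m hm
    have hmem : (m * h : ℝ) ∈ Set.Icc (0 : ℝ) (k * h) :=
      ⟨by positivity, mul_le_mul_of_nonneg_right (by exact_mod_cast hm) hh.le⟩
    refine ⟨fun y hy => (hdiff _ hmem y hy).1, fun y hy => ?_, fun y hy z hz => ?_⟩
    · linarith [(hdiff _ hmem y hy).2, le_abs_self L₁]
    · exact (hlip _ hmem y hy z hz).trans
        (mul_le_mul_of_nonneg_right (le_abs_self L₂) (norm_nonneg _))
  set b : ℝ := h * (d * (2 * ε + L * (M * h))) + 2 * (L * (M * h) * h) +
    τ * (|R| + M * |T|) with hb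
  have hb0 : 0 ≤ b := by positivity
  have htime : ∀ m : ℕ, m ≤ k → m * h ≤ |T| := fun m hm =>
    (mul_le_mul_of_nonneg_right (by exact_mod_cast hm) hh.le).trans (hkT.trans (le_abs_self T))
  have hglobal : ∀ m : ℕ, m ≤ k → (1 + L * h) ^ m * (m * b) + (M + 1) * h ≤
      A * (2 * d) * ε + (A * ((d + 2) * (L * M)) + (M + 1)) * h + A * (|R| + M * |T|) * τ / h := by
    intro m hm
    have hmT := htime m hm
    have h1 : (1 + L * h) ^ m ≤ Real.exp (L * |T|) := by
      calc (1 + L * h) ^ m ≤ Real.exp (L * h) ^ m :=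
            pow_le_pow_left₀ (by positivity) (by linarith [Real.add_one_le_exp (L * h)]) m
        _ = Real.exp (L * (m * h)) := by rw [← Real.exp_nat_mul]; ring_nf
        _ ≤ _ := Real.exp_le_exp.2 (mul_le_mul_of_nonneg_left hmT hL)
    have h2 : m * b ≤ |T| * (b / h) := by
      have h3 := mul_le_mul_of_nonneg_right hmT (div_nonneg hb0 hh.le)
      calc m * b = m * h * (b / h) := by field_simp
        _ ≤ _ := h3
    have h4 := mul_le_mul h1 h2 (by positivity) (Real.exp_nonneg _)
    have h5 : Real.exp (L * |T|) * (|T| * (b / h)) + (M + 1) * h =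
        A * (2 * d) * ε + (A * ((d + 2) * (L * M)) + (M + 1)) * h +
          A * (|R| + M * |T|) * τ / h := by
      rw [hA, hb]
      field_simp
      ring
    linarith
  have hmain : ∀ m : ℕ, m ≤ k → (X m).IsProper ∧ ‖(X m).toTensor‖ ≤ |R| + M * (m * h) ∧
      ‖W (m * h) - (X m).toTensor‖ ≤ (1 + L * h) ^ m * (m * b) := by
    intro m
    induction m with
    | zero =>
      intro _
      refine ⟨hX0, ?_, ?_⟩
      · simpa [hXW] using hR.trans (le_abs_self R)
      · simp [hXW]
    | succ m ih =>
      intro hm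
      have hmk : m < k := hm
      obtain ⟨hXm, hnorm, herr⟩ := ih hmk.le
      have hroom : ‖W (m * h) - (X m).toTensor‖ + M * h < δ := by
        linarith [hglobal m hmk.le]
      have hYball : (X m).toTensor ∈ Metric.ball (W (m * h)) δ := by
        rw [mem_ball_iff_norm']
        have := mul_nonneg hM hh.le
        linarith
      have hWball : W (m * h) ∈ Metric.ball (W (m * h)) δ := Metric.mem_ball_self hδ
      have hf := hball m hmk.le
      obtain ⟨Z, hZ, hZε⟩ := htan m hmk _ hYball hXm.toTensor_mem
      obtain ⟨hproper, hnorm', hloc⟩ := (hstep m hmk).local_error hXm hh hτ hf hM hL hroom hZ hZε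
      have hsucc : ((m + 1 : ℕ) : ℝ) * h = m * h + h := by push_cast; ring
      have hflow : IsGradientFlow 𝓛 h (fun t => W (m * h + t)) := by
        refine hW.shift (by positivity) ?_
        rw [← hsucc]
        exact mul_le_mul_of_nonneg_right (by exact_mod_cast hm) hh.le
      have hWeuler : ‖W (m * h + h) - W (m * h) + h • gradient 𝓛 (W (m * h))‖ ≤
          L * (M * h) * h := by
        have hroom' : ‖W (m * h) - W (m * h + 0)‖ + M * h < δ := by
          rw [add_zero, sub_self, norm_zero]
          linarith [norm_nonneg (W (m * h) - (X m).toTensor)]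
        have h1 := hf.norm_flow_sub_euler_le hM hL LinearIsometry.id hh.le hflow hroom'
        have hid : (LinearIsometry.id : Tensor n →ₗᵢ[ℝ] Tensor n).toContinuousLinearMap.adjoint =
            ContinuousLinearMap.id ℝ _ := ContinuousLinearMap.adjoint_id
        rw [hid] at h1
        simpa using h1
      rw [hsucc]
      refine ⟨hproper, ?_, ?_⟩
      · linarith
      · have hglip := hf.norm_gradient_sub_le _ hYball _ hWball
        rw [norm_sub_rev (X m).toTensor] at hglip
        have hXT : ‖(X m).toTensor‖ + M * h ≤ |R| + M * |T| := by
          have h1 := mul_le_mul_of_nonneg_left (htime (m + 1) hm) hM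
          rw [hsucc] at h1
          linarith
        have hτX := mul_le_mul_of_nonneg_left hXT hτ
        have hsplit : W (m * h + h) - (X (m + 1)).toTensor =
            (W (m * h) - (X m).toTensor) +
            h • (gradient 𝓛 (X m).toTensor - gradient 𝓛 (W (m * h))) +
            (W (m * h + h) - W (m * h) + h • gradient 𝓛 (W (m * h))) +
            ((X m).toTensor + h • (-gradient 𝓛 (X m).toTensor) - (X (m + 1)).toTensor) := by
          rw [smul_sub, smul_neg]
          abel
        refine le_pow_mul_of_le_one_add_mul_add (by positivity) hb0 ?_ herr
        rw [hsplit]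
        refine (norm_add_le _ _).trans ((add_le_add_left norm_add₃_le _).trans ?_)
        rw [norm_smul, Real.norm_of_nonneg hh.le]
        have h1 := mul_le_mul_of_nonneg_left hglip hh.le
        rw [hb]
        linarith
  have hfinal := hglobal k le_rfl
  have hpos : 0 ≤ (M + 1) * h := by positivity
  linarith [(hmain k le_rfl).2.2]
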